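/- Let $X$ be a real Banach space, and let $\tau=\tau(X^*,X)$ be the Mackey topology on $X^*$, i.e. the topology of uniform convergence on the absolutely convex $\sigma(X,X^*)$-compact subsets of $X$. Call a subset of $X^*$ Mackey-precompact if it is totally bounded for $\tau$. Let $\tau^0$ be the topology on $X^{**}$ of uniform convergence on the Mackey-precompact subsets of $X^*$. Suppose that on every norm-bounded subset of $X^{**}$ the topologies induced by $\tau^0$ and by the weak* topology $\sigma(X^{**},X^*)$ coincide. Then every Mackey-precompact subset of $X^*$ is relatively compact for the norm of $X^*$ and, moreover, $X$ has no linear subspace isomorphic (linearly homeomorphic) to $\ell_1$. -/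

import Mathlib

noncomputable section

/-- The weakly compact absolutely convex subsets of `X`. -/
def weaklyCompactDisks (X : Type*) [NormedAddCommGroup X] [NormedSpace ℝ X] : Set (Set X) :=
  {K | IsCompact (toWeakSpace ℝ X '' K) ∧ AbsConvex ℝ K}

/-- The dual `X*` with the Mackey topology `τ(X*, X)`, the topology (and uniformity) of uniform
convergence on the weakly compact absolutely convex subsets of `X`. -/
abbrev MackeyDual (X : Type*) [NormedAddCommGroup X] [NormedSpace ℝ X] : Type _ :=
  UniformConvergenceCLM (RingHom.id ℝ) (E := X) ℝ (weaklyCompactDisks X)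

/-- The identity map from the dual `X*` to the Mackey dual. -/
def toMackeyDual (X : Type*) [NormedAddCommGroup X] [NormedSpace ℝ X] :
    StrongDual ℝ X ≃ MackeyDual X :=
  UniformConvergenceCLM.ofFun (RingHom.id ℝ) ℝ (weaklyCompactDisks X)

/-- A subset of `X*` is Mackey-precompact if it is totally bounded for the uniformity
of the Mackey topology `τ(X*, X)`. -/
def MackeyPrecompact {X : Type*} [NormedAddCommGroup X] [NormedSpace ℝ X]
    (P : Set (StrongDual ℝ X)) : Prop :=
  TotallyBounded (toMackeyDual X '' P)

/-- The topology `τ⁰` on `X**` of uniform convergence on the Mackey-precompact subsets of `X*`. -/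
def tauZero (X : Type*) [NormedAddCommGroup X] [NormedSpace ℝ X] :
    TopologicalSpace (StrongDual ℝ (StrongDual ℝ X)) :=
  TopologicalSpace.induced
    (UniformConvergenceCLM.ofFun (RingHom.id ℝ) ℝ
      {P : Set (StrongDual ℝ X) | MackeyPrecompact P})
    inferInstance

/-- The weak* topology `σ(X**, X*)` on `X**`. -/
def weakStarBidual (X : Type*) [NormedAddCommGroup X] [NormedSpace ℝ X] :
    TopologicalSpace (StrongDual ℝ (StrongDual ℝ X)) :=
  TopologicalSpace.induced
    (StrongDual.toWeakDual : StrongDual ℝ (StrongDual ℝ X) → WeakDual ℝ (StrongDual ℝ X))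
    inferInstance

/-- `X` contains a linear subspace isomorphic to `ℓ¹`. -/
def ContainsEllOne (X : Type*) [NormedAddCommGroup X] [NormedSpace ℝ X] : Prop :=
  ∃ Y : Submodule ℝ X, Nonempty (Y ≃L[ℝ] lp (fun _ : ℕ => ℝ) 1)

end

open Filter Topology Set MeasureTheory
open scoped CompactlySupported

/-! On the bidual unit ball the hypothesis makes smallness on a Mackey-precompact `P` follow from
smallness on finitely many functionals. By Hahn-Banach on the quotient, `P` then lies near their
finite-dimensional span (`totallyBounded_of_equicontinuous_zero`), so it is totally bounded in the
complete space `X*`.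

If `X` contains `ℓ¹`, this compactness fails. Sign functionals on `ℓ¹` extend to `X` with bounded
norms; a limit measure `μ` of averages of their point masses makes the basis `e n` orthonormal in
`L²(μ)`, like Rademacher functions. The map `X → C(D) → L²(μ)` is completely continuous, so pairing
with this orthonormal sequence gives functionals `p n` tending to zero in the Mackey topology. Their
range is precompact, but `p n (e m) = δ` excludes norm-convergent subsequences. -/

/-! ### Weak sequential compactness -/

/-- A weakly compact set in a real normed space is weakly sequentially compact. -/
theorem exists_weakly_convergent_subseq {X : Type*} [NormedAddCommGroup X] [NormedSpace ℝ X]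
    {K : Set X} (hK : IsCompact (toWeakSpace ℝ X '' K)) (x : ℕ → X) (hx : ∀ n, x n ∈ K) :
    ∃ (a : X) (φ : ℕ → ℕ), StrictMono φ ∧
      ∀ f : StrongDual ℝ X, Tendsto (fun n => f (x (φ n))) atTop (𝓝 (f a)) := by
  let Z : Submodule ℝ X := (Submodule.span ℝ (range x)).topologicalClosure
  have hxZ : ∀ n, x n ∈ Z := fun n =>
    Submodule.le_topologicalClosure _ (Submodule.subset_span (mem_range_self n))
  have hZsep : TopologicalSpace.IsSeparable (Z : Set X) := by
    have h1 : TopologicalSpace.IsSeparable (Submodule.span ℝ (range x) : Set X) :=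
      (countable_range x).isSeparable.span
    simpa [Z] using h1.closure
  have hZclosed : IsClosed (toWeakSpace ℝ X '' (Z : Set X)) := by
    have hc : IsClosed (Z : Set X) := Submodule.isClosed_topologicalClosure _
    have := Convex.toWeakSpace_closure ℝ (s := (Z : Set X)) Z.convex
    rw [hc.closure_eq] at this
    rw [this]
    exact isClosed_closure
  obtain ⟨c, hc, hZc⟩ := hZsep
  have hcne : c.Nonempty := by
    rcases c.eq_empty_or_nonempty with h | h
    · subst h
      simpa using hZc Z.zero_mem
    · exact h
  obtain ⟨d, rfl⟩ := hc.exists_eq_range hcne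
  -- Functionals norming a dense sequence separate the points of `Z`; countably many suffice to
  -- metrize the weakly compact set `S`.
  choose g hg1 hg2 using fun j => exists_dual_vector'' ℝ (d j)
  have hsep : ∀ y ∈ Z, (∀ j, g j y = 0) → y = 0 := by
    intro y hy h0
    by_contra hne
    have hpos : 0 < ‖y‖ := norm_pos_iff.2 hne
    obtain ⟨_, ⟨j, rfl⟩, hj⟩ := Metric.mem_closure_iff.1 (hZc hy) (‖y‖ / 2) (half_pos hpos)
    have h1 : ‖d j‖ ≤ ‖d j - y‖ := by
      have h2 : g j (d j - y) = ‖d j‖ := by rw [map_sub, h0, sub_zero]; exact hg2 j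
      rw [← h2]
      exact (le_abs_self _).trans ((g j).le_of_opNorm_le (hg1 j) _ |>.trans (by simp))
    have h3 : ‖y‖ ≤ ‖d j‖ + ‖d j - y‖ := by
      simpa using norm_sub_le (d j) (d j - y)
    rw [dist_comm, dist_eq_norm] at hj
    linarith
  let S : Set (WeakSpace ℝ X) := toWeakSpace ℝ X '' K ∩ toWeakSpace ℝ X '' (Z : Set X)
  have hS : IsCompact S := hK.inter_right hZclosed
  have : CompactSpace S := isCompact_iff_compactSpace.1 hS
  have hev : ∀ f : StrongDual ℝ X,
      Continuous fun y : WeakSpace ℝ X => f ((toWeakSpace ℝ X).symm y) := fun f =>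
    WeakBilin.eval_continuous _ f
  have : TopologicalSpace.MetrizableSpace S := by
    refine Metric.PiNatEmbed.TopologicalSpace.MetrizableSpace.of_countable_separating
      (fun j (y : S) => g j ((toWeakSpace ℝ X).symm y.1))
      (fun j => (hev (g j)).comp continuous_subtype_val) ?_
    rintro ⟨_, _, y, hy, rfl⟩ ⟨_, _, z, hz, rfl⟩ hne
    by_contra! hcon
    refine hne (Subtype.ext ?_)
    have : y - z = 0 := hsep _ (Z.sub_mem hy hz) fun j => by
      have := hcon j
      simp only [LinearEquiv.symm_apply_apply] at this
      rw [map_sub, this, sub_self]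
    simp [sub_eq_zero.1 this]
  obtain ⟨a, φ, hφ, ha⟩ := CompactSpace.tendsto_subseq
    (fun n => (⟨toWeakSpace ℝ X (x n), mem_image_of_mem _ (hx n), mem_image_of_mem _ (hxZ n)⟩ : S))
  refine ⟨(toWeakSpace ℝ X).symm a.1, φ, hφ, fun f => ?_⟩
  simpa [Function.comp_def] using
    (((hev f).comp continuous_subtype_val).tendsto a).comp ha

/-! ### Limit measures and Rademacher orthogonality -/

/-- A limit of finite averages of point masses on a compact space. -/
theorem exists_measure_of_tendsto_expect {D ι : Type*} [TopologicalSpace D] [CompactSpace D]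
    [T2Space D] [MeasurableSpace D] [BorelSpace D] (s : ℕ → Finset ι) (π : ι → D) :
    ∃ μ : Measure D, IsFiniteMeasure μ ∧ ∀ (g : C(D, ℝ)) (c : ℝ),
      Tendsto (fun N => (s N).expect fun i => g (π i)) atTop (𝓝 c) → ∫ t, g t ∂μ = c := by
  -- Along an ultrafilter all the bounded averages converge at once, and the limits form a positive
  -- functional.
  let U : Ultrafilter ℕ := Ultrafilter.of atTop
  have hU : (U : Filter ℕ) ≤ atTop := Ultrafilter.of_le _
  have hlim : ∀ g : C_c(D, ℝ), ∃ c : ℝ,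
      Tendsto (fun N => (s N).expect fun i => g (π i)) U (𝓝 c) := by
    intro g
    obtain ⟨M, hM⟩ := isCompact_univ.exists_bound_of_continuousOn
      (f := g) g.continuous.continuousOn
    have hM' : ∀ t, |g t| ≤ M := fun t => hM t trivial
    -- The bound is `|M|` because `M` may be negative when `D` is empty, while an empty average is
    -- `0`.
    have hmem : ∀ N, ((s N).expect fun i => g (π i)) ∈ Icc (-|M|) |M| := by
      intro N
      rcases (s N).eq_empty_or_nonempty with h | h
      · simp [h]
      · have hM0 := le_abs_self M
        exact ⟨Finset.le_expect h fun i _ => by have := abs_le.1 (hM' (π i)); linarith,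
          Finset.expect_le h fun i _ => by have := abs_le.1 (hM' (π i)); linarith⟩
    obtain ⟨c, -, hc⟩ := (isCompact_Icc (a := -|M|) (b := |M|)).ultrafilter_le_nhds
      (U.map fun N => (s N).expect fun i => g (π i))
      (tendsto_principal.2 (Eventually.of_forall hmem))
    exact ⟨c, hc⟩
  choose L hL using hlim
  let Λ : C_c(D, ℝ) →ₚ[ℝ] ℝ := PositiveLinearMap.mk₀
    { toFun := L
      map_add' := fun g h => tendsto_nhds_unique (hL (g + h)) (by
        simpa [Finset.expect_add_distrib] using (hL g).add (hL h))
      map_smul' := fun r g => tendsto_nhds_unique (hL (r • g)) (by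
        simpa [Finset.mul_expect] using (hL g).const_mul r) }
    (fun g hg => ge_of_tendsto' (hL g) fun N => Finset.expect_nonneg fun i _ => hg (π i))
  refine ⟨RealRMK.rieszMeasure Λ, inferInstance, fun g c hc => ?_⟩
  let g' : C_c(D, ℝ) := ⟨g, HasCompactSupport.of_compactSpace _⟩
  have h1 := RealRMK.integral_rieszMeasure Λ g'
  have h2 : Λ g' = c := tendsto_nhds_unique (hL g') (hc.mono_left hU)
  exact h1.trans h2

/-- Toggling the membership of `m` flips only the first sign, so the terms cancel in pairs. -/
theorem expect_powerset_range_sign_mul_sign {m n N : ℕ} (hmn : m ≠ n) (hm : m < N) :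
    ((Finset.range N).powerset.expect fun s =>
      (if m ∈ s then (1 : ℝ) else -1) * (if n ∈ s then (1 : ℝ) else -1)) = 0 := by
  rw [Finset.expect]
  rw [Finset.sum_involution (fun s _ => symmDiff s {m}), smul_zero]
  · intro s _
    by_cases h : m ∈ s <;> by_cases h' : n ∈ s <;>
      simp [Finset.mem_symmDiff, h, h', hmn.symm]
  · intro s _ _ h
    have : m ∈ symmDiff s {m} ↔ m ∈ s := by rw [h]
    simp [Finset.mem_symmDiff] at this
  · intro s hs
    simp only [Finset.mem_powerset] at hs ⊢
    intro k hk
    simp only [Finset.mem_symmDiff, Finset.mem_singleton] at hk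
    rcases hk with ⟨h, -⟩ | ⟨rfl, -⟩
    · exact hs h
    · simpa using hm
  · intro s _
    simp

/-! ### Completely continuous operators and Mackey-null sequences -/

/-- Banach-Steinhaus is applied on the dual, which is complete even if `X` is not. -/
theorem exists_norm_sub_le_of_weakly_convergent {X : Type*} [NormedAddCommGroup X]
    [NormedSpace ℝ X] {x : ℕ → X} {a : X}
    (hx : ∀ f : StrongDual ℝ X, Tendsto (fun n => f (x n)) atTop (𝓝 (f a))) :
    ∃ M, ∀ n, ‖x n - a‖ ≤ M := by
  obtain ⟨M, hM⟩ := banach_steinhaus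
    (g := fun n => NormedSpace.inclusionInDoubleDual ℝ X (x n - a)) fun g => by
      obtain ⟨R, hR⟩ := ((hx g).sub_const (g a)).norm.bddAbove_range
      refine ⟨R, fun n => hR ⟨n, ?_⟩⟩
      simp
  exact ⟨M, fun n =>
    ((NormedSpace.inclusionInDoubleDualLi ℝ).norm_map (x n - a)).symm.trans_le (hM n)⟩

/-- An operator that factors through the inclusion of `C(D)` into `L²` is completely continuous. -/
theorem tendsto_toLp_of_weakly_convergent {X D : Type*} [NormedAddCommGroup X] [NormedSpace ℝ X]
    [TopologicalSpace D] [CompactSpace D] [MeasurableSpace D] [BorelSpace D]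
    (μ : Measure D) [IsFiniteMeasure μ] (ev : X →L[ℝ] C(D, ℝ)) {x : ℕ → X} {a : X}
    (hx : ∀ f : StrongDual ℝ X, Tendsto (fun n => f (x n)) atTop (𝓝 (f a))) :
    Tendsto (fun n => ContinuousMap.toLp 2 μ ℝ (ev (x n))) atTop
      (𝓝 (ContinuousMap.toLp 2 μ ℝ (ev a))) := by
  obtain ⟨M, hM⟩ := exists_norm_sub_le_of_weakly_convergent hx
  have hb : ∀ n t, |ev (x n - a) t| ≤ ‖ev‖ * M := fun n t =>
    ((ev (x n - a)).norm_coe_le_norm t).trans ((ev.le_opNorm _).trans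
      (mul_le_mul_of_nonneg_left (hM n) (norm_nonneg _)))
  have hdom : Tendsto (fun n => ∫ t, ev (x n - a) t * ev (x n - a) t ∂μ) atTop (𝓝 0) := by
    have h := tendsto_integral_of_dominated_convergence (μ := μ)
      (F := fun n t => ev (x n - a) t * ev (x n - a) t) (f := fun _ => 0)
      (fun _ => ‖ev‖ * M * (‖ev‖ * M))
      (fun n => ((ev (x n - a) * ev (x n - a)).continuous.integrable_of_hasCompactSupport
        (HasCompactSupport.of_compactSpace _)).aestronglyMeasurable)
      (integrable_const _)
      (fun n => .of_forall fun t => by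
        rw [norm_mul]
        exact mul_le_mul (hb n t) (hb n t) (abs_nonneg _) ((abs_nonneg _).trans (hb n t)))
      (.of_forall fun t => by
        have h1 := (hx ((ContinuousMap.evalCLM ℝ t).comp ev)).sub_const (ev a t)
        have h2 : Tendsto (fun n => ev (x n - a) t) atTop (𝓝 0) := by simpa using h1
        simpa using h2.mul h2)
    simpa using h
  rw [tendsto_iff_norm_sub_tendsto_zero]
  have h := hdom.sqrt
  rw [Real.sqrt_zero] at h
  refine h.congr fun n => ?_
  rw [← map_sub, ← map_sub, norm_eq_sqrt_real_inner, ContinuousMap.inner_toLp]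
  simp

/-- A completely continuous operator into an inner product space pulls orthonormal sequences back
to Mackey-precompact sets. -/
theorem mackeyPrecompact_range_inner_comp {X H : Type*} [NormedAddCommGroup X] [NormedSpace ℝ X]
    [NormedAddCommGroup H] [InnerProductSpace ℝ H] (S : X →L[ℝ] H)
    (hS : ∀ (x : ℕ → X) (a : X),
      (∀ f : StrongDual ℝ X, Tendsto (fun n => f (x n)) atTop (𝓝 (f a))) →
        Tendsto (fun n => S (x n)) atTop (𝓝 (S a)))
    {v : ℕ → H} (hv : Orthonormal ℝ v) :
    MackeyPrecompact (range fun n => (innerSL ℝ (v n)).comp S) := by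
  -- Bessel's inequality: an orthonormal sequence is weakly null.
  have hv0 : ∀ y, Tendsto (fun n => ‖inner ℝ (v n) y‖) atTop (𝓝 0) := by
    intro y
    have h := (hv.inner_products_summable y).tendsto_atTop_zero.sqrt
    simpa only [Real.sqrt_zero, Real.sqrt_sq (norm_nonneg _)] using h
  have hlim : Tendsto (fun n => toMackeyDual X ((innerSL ℝ (v n)).comp S)) atTop (𝓝 0) := by
    rw [UniformConvergenceCLM.tendsto_iff_tendstoUniformlyOn]
    rintro K ⟨hK, -⟩
    rw [Metric.tendstoUniformlyOn_iff]
    intro ε hε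
    by_contra hcon
    obtain ⟨ψ, hψ, hbad⟩ := extraction_of_frequently_atTop (not_eventually.1 hcon)
    push Not at hbad
    choose x hxK hx using hbad
    have hx' : ∀ k, ε ≤ ‖inner ℝ (v (ψ k)) (S (x k))‖ := fun k => by
      have h := hx k
      rw [dist_comm, dist_eq_norm] at h
      exact h.trans_eq (congrArg norm (sub_zero _))
    obtain ⟨a, φ, hφ, ha⟩ := exists_weakly_convergent_subseq hK x hxK
    have hsum := (tendsto_iff_norm_sub_tendsto_zero.1 (hS _ a ha)).add
      ((hv0 (S a)).comp ((hψ.comp hφ).tendsto_atTop))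
    rw [add_zero] at hsum
    refine hε.not_ge (ge_of_tendsto' hsum fun k => (hx' (φ k)).trans ?_)
    -- The first term is small by complete continuity, the second because `v` is weakly null.
    have hsplit : inner ℝ (v (ψ (φ k))) (S (x (φ k))) =
        inner ℝ (v (ψ (φ k))) (S (x (φ k)) - S a) + inner ℝ (v (ψ (φ k))) (S a) := by
      rw [← inner_add_right, sub_add_cancel]
    rw [hsplit]
    refine (norm_add_le _ _).trans (add_le_add_left ?_ _)
    simpa [hv.1] using norm_inner_le_norm (𝕜 := ℝ) (v (ψ (φ k))) (S (x (φ k)) - S a)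
  rw [MackeyPrecompact, ← range_comp]
  exact hlim.cauchySeq.totallyBounded_range

/-- If every sign pattern on a sequence `e` is attained by a functional of norm at most `C`, then
`e` has a Mackey-precompact biorthogonal sequence. -/
theorem exists_mackeyPrecompact_biorthogonal {X : Type*} [NormedAddCommGroup X] [NormedSpace ℝ X]
    (e : ℕ → X) (C : ℝ) (f : Finset ℕ → StrongDual ℝ X) (hfC : ∀ s, ‖f s‖ ≤ C)
    (hfe : ∀ s n, f s (e n) = if n ∈ s then 1 else -1) :
    ∃ p : ℕ → StrongDual ℝ X, MackeyPrecompact (range p) ∧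
      ∀ m n, p n (e m) = if n = m then 1 else 0 := by
  have hC : 0 ≤ C := (norm_nonneg _).trans (hfC ∅)
  let D : Set (WeakDual ℝ X) := WeakDual.toStrongDual ⁻¹' Metric.closedBall 0 C
  have hDmem : ∀ φ : WeakDual ℝ X, φ ∈ D ↔ ‖WeakDual.toStrongDual φ‖ ≤ C := fun φ =>
    mem_closedBall_zero_iff
  have : CompactSpace D := isCompact_iff_compactSpace.1 (WeakDual.isCompact_closedBall 0 C)
  let _ : MeasurableSpace D := borel D
  have : BorelSpace D := ⟨rfl⟩
  let ev : X →L[ℝ] C(D, ℝ) := LinearMap.mkContinuous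
    { toFun := fun x => ⟨fun t => t.1 x, (WeakDual.eval_continuous x).comp continuous_subtype_val⟩
      map_add' := fun x y => ContinuousMap.ext fun t => map_add t.1 x y
      map_smul' := fun r x => ContinuousMap.ext fun t => map_smul t.1 r x }
    C fun x => (ContinuousMap.norm_le _ (by positivity)).2 fun t =>
      (WeakDual.toStrongDual t.1).le_of_opNorm_le ((hDmem _).1 t.2) x
  have hev : ∀ x t, ev x t = t.1 x := fun _ _ => rfl
  obtain ⟨μ, hμ, hμlim⟩ := exists_measure_of_tendsto_expect (D := D)
    (fun N => (Finset.range N).powerset)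
    (fun s => ⟨StrongDual.toWeakDual (f s), (hDmem _).2 (hfC s)⟩)
  have horth : ∀ m n, inner ℝ (ContinuousMap.toLp 2 μ ℝ (ev (e m)))
      (ContinuousMap.toLp 2 μ ℝ (ev (e n))) = if m = n then (1 : ℝ) else 0 := by
    intro m n
    rw [ContinuousMap.inner_toLp]
    -- The averages are constant once `N > n`, so the integral is that constant.
    refine hμlim (ev (e n) * ev (e m)) _ (tendsto_const_nhds.congr' ?_)
    filter_upwards [eventually_gt_atTop n] with N hN
    have hval : ∀ s k, StrongDual.toWeakDual (f s) (e k) = if k ∈ s then (1 : ℝ) else -1 := hfe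
    simp only [ContinuousMap.mul_apply, hev, hval]
    split_ifs with h
    · subst h
      rw [Finset.expect_congr (g := fun _ => (1 : ℝ)) rfl fun s _ => by split_ifs <;> norm_num]
      exact (Finset.expect_const (Finset.powerset_nonempty _) _).symm
    · exact (expect_powerset_range_sign_mul_sign (Ne.symm h) hN).symm
  exact ⟨_, mackeyPrecompact_range_inner_comp ((ContinuousMap.toLp 2 μ ℝ).comp ev)
    (fun x a hx => tendsto_toLp_of_weakly_convergent μ ev hx) (orthonormal_iff_ite.2 horth),
    fun m n => horth n m⟩

/-! ### Spaces containing `ℓ¹` -/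

/-- The functional on `ℓ¹` with coefficients `1` on `s` and `-1` off `s`. -/
noncomputable def ellOneSign (s : Finset ℕ) : StrongDual ℝ (lp (fun _ : ℕ => ℝ) 1) :=
  have hs (y : lp (fun _ : ℕ => ℝ) 1) :
      Summable fun n => ‖(if n ∈ s then (1 : ℝ) else -1) * y n‖ := by
    refine Summable.congr (f := fun n => ‖y n‖) (by simpa using y.2.summable) fun n => ?_
    split_ifs <;> simp
  LinearMap.mkContinuous
    { toFun := fun y => ∑' n, (if n ∈ s then (1 : ℝ) else -1) * y n
      map_add' := fun y z => by
        rw [← (hs y).of_norm.tsum_add (hs z).of_norm]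
        exact tsum_congr fun n => by simp [mul_add]
      map_smul' := fun r y => by
        rw [RingHom.id_apply, smul_eq_mul, ← tsum_mul_left]
        exact tsum_congr fun n => by
          rw [lp.coeFn_smul, Pi.smul_apply, smul_eq_mul, mul_left_comm] }
    1 (fun y => by
      rw [one_mul]
      refine (norm_tsum_le_tsum_norm (hs y)).trans (le_of_eq ?_)
      rw [lp.norm_eq_tsum_rpow (by simp)]
      simp only [ENNReal.toReal_one, Real.rpow_one, div_one]
      exact tsum_congr fun n => by split_ifs <;> simp)

theorem norm_ellOneSign_le (s : Finset ℕ) : ‖ellOneSign s‖ ≤ 1 := by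
  unfold ellOneSign
  exact LinearMap.mkContinuous_norm_le _ zero_le_one _

theorem ellOneSign_single (s : Finset ℕ) (n : ℕ) :
    ellOneSign s (lp.single 1 n 1) = if n ∈ s then 1 else -1 := by
  change ∑' k, (if k ∈ s then (1 : ℝ) else -1) * lp.single (E := fun _ : ℕ => ℝ) 1 n 1 k = _
  rw [tsum_eq_single n fun k hk => by rw [lp.single_apply_ne 1 n _ hk, mul_zero],
    lp.single_apply_self, mul_one]

/-- The dual of a space containing `ℓ¹` has a Mackey-precompact set that is not relatively compact
in norm. -/
theorem exists_mackeyPrecompact_not_isCompact_closure {X : Type*} [NormedAddCommGroup X]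
    [NormedSpace ℝ X] (hX : ContainsEllOne X) :
    ∃ P : Set (StrongDual ℝ X), MackeyPrecompact P ∧ ¬ IsCompact (closure P) := by
  obtain ⟨Y, ⟨T⟩⟩ := hX
  have hext (s : Finset ℕ) := exists_extension_norm_eq Y
    ((ellOneSign s).comp (T : Y →L[ℝ] lp (fun _ : ℕ => ℝ) 1))
  choose f hf hfn using hext
  obtain ⟨p, hp, hpe⟩ := exists_mackeyPrecompact_biorthogonal
    (fun n => (T.symm (lp.single 1 n 1) : X)) 
    ‖(T : Y →L[ℝ] lp (fun _ : ℕ => ℝ) 1)‖ f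
    (fun s => by
      rw [hfn]
      refine (ContinuousLinearMap.opNorm_comp_le _ _).trans ?_
      exact mul_le_of_le_one_left (norm_nonneg _) (norm_ellOneSign_le s))
    (fun s n => by rw [hf]; simpa using ellOneSign_single s n)
  refine ⟨range p, hp, fun hc => ?_⟩
  obtain ⟨q, -, φ, hφ, hq⟩ := hc.tendsto_subseq fun n => subset_closure (mem_range_self n)
  let e : ℕ → X := fun n => (T.symm (lp.single 1 n 1) : X)
  replace hpe : ∀ m n, p n (e m) = if n = m then 1 else 0 := hpe
  have heb : ∀ n, ‖e n‖ ≤ ‖(T.symm : lp (fun _ : ℕ => ℝ) 1 →L[ℝ] Y)‖ := fun n => by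
    have := (T.symm : lp (fun _ : ℕ => ℝ) 1 →L[ℝ] Y).le_opNorm
      (lp.single (E := fun _ : ℕ => ℝ) 1 n 1)
    rwa [lp.norm_single (by simp), norm_one, mul_one] at this
  -- A subsequential norm limit `q` kills every `e m`, yet `p (φ k) - q` equals `1` on the bounded
  -- vector `e (φ k)`.
  have hqe : ∀ m, q (e m) = 0 := by
    intro m
    refine tendsto_nhds_unique (((ContinuousLinearMap.apply ℝ ℝ (e m)).continuous.tendsto q).comp hq)
      (tendsto_const_nhds.congr' ?_)
    filter_upwards [eventually_gt_atTop m] with k hk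
    have : φ k ≠ m := (hk.trans_le hφ.le_apply).ne'
    simp [hpe, this]
  have h0 : Tendsto (fun k => ‖p (φ k) - q‖ * ‖(T.symm : lp (fun _ : ℕ => ℝ) 1 →L[ℝ] Y)‖) atTop (𝓝 0) := by
    simpa using (tendsto_iff_norm_sub_tendsto_zero.1 hq).mul_const ‖(T.symm : lp (fun _ : ℕ => ℝ) 1 →L[ℝ] Y)‖
  refine zero_lt_one.not_ge (ge_of_tendsto' h0 fun k => ?_)
  have h1 : (p (φ k) - q) (e (φ k)) = 1 := by
    simp [hpe, hqe]
  calc (1 : ℝ) = ‖(p (φ k) - q) (e (φ k))‖ := by rw [h1, norm_one]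
    _ ≤ ‖p (φ k) - q‖ * ‖e (φ k)‖ := ContinuousLinearMap.le_opNorm _ _
    _ ≤ _ := mul_le_mul_of_nonneg_left (heb _) (norm_nonneg _)

/-! ### Total boundedness and neighbourhoods of zero -/

/-- A set of functionals is totally bounded if the bidual unit ball is weak* equicontinuous at `0`
on it. -/
theorem totallyBounded_of_equicontinuous_zero {E : Type*} [NormedAddCommGroup E] [NormedSpace ℝ E]
    {P : Set E} (hP : ∀ ε > 0, ∃ (F : Set E) (δ : ℝ), F.Finite ∧ 0 < δ ∧
      ∀ φ : StrongDual ℝ E, ‖φ‖ ≤ 1 → (∀ g ∈ F, |φ g| < δ) → ∀ p ∈ P, |φ p| < ε) :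
    TotallyBounded P := by
  obtain ⟨R, hR⟩ : ∃ R, ∀ p ∈ P, ‖p‖ ≤ R := by
    obtain ⟨F, δ, hF, hδ, h⟩ := hP 1 one_pos
    obtain ⟨M, hM0, hM⟩ := hF.isBounded.exists_pos_norm_le
    -- Scaling by `t` keeps a functional in the unit ball and makes it smaller than `δ` on `F`,
    -- since `t * M < δ`.
    have ht0 : 0 < min 1 (δ / (M + 1)) := by positivity
    set t := min 1 (δ / (M + 1))
    refine ⟨t⁻¹, fun p hp => ?_⟩
    obtain ⟨φ, hφ, hφp⟩ := exists_dual_vector'' ℝ p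
    have h1 := h (t • φ)
      (by rw [norm_smul, Real.norm_of_nonneg ht0.le]
          exact mul_le_one₀ (min_le_left _ _) (norm_nonneg _) hφ)
      (fun g hg => by
        have h2 : |φ g| ≤ M := (φ.le_of_opNorm_le hφ g).trans (by simpa using hM g hg)
        have h3 : t * (M + 1) ≤ δ := (le_div_iff₀ (by positivity)).1 (min_le_right _ _)
        rw [_root_.smul_apply, smul_eq_mul, abs_mul, abs_of_pos ht0]
        nlinarith) p hp
    rw [_root_.smul_apply, hφp, smul_eq_mul, abs_mul, abs_of_pos ht0] at h1
    simp only [RCLike.ofReal_real_eq_id, id_eq, abs_norm] at h1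
    rw [← one_div, le_div_iff₀ ht0]
    linarith
  rw [Metric.totallyBounded_iff]
  intro ε hε
  obtain ⟨F, δ, hF, hδ, h⟩ := hP (ε / 2) (half_pos hε)
  let S := Submodule.span ℝ F
  have : FiniteDimensional ℝ S := FiniteDimensional.span_of_finite ℝ hF
  have hnear : ∀ p ∈ P, ∃ s ∈ S, ‖p - s‖ < ε / 2 := by
    intro p hp
    -- A functional on the quotient norming the class of `p` vanishes on `F`, so the hypothesis
    -- bounds the distance from `p` to `S`.
    obtain ⟨φ, hφ, hφp⟩ := exists_dual_vector'' ℝ (S.mkQ p)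
    have h1 := h (φ.comp S.mkQL)
      (ContinuousLinearMap.opNorm_le_bound _ zero_le_one fun x =>
        (φ.le_of_opNorm_le hφ _).trans
          (mul_le_mul_of_nonneg_left (Submodule.Quotient.norm_mk_le S x) zero_le_one))
      (fun g hg => by
        have : S.mkQ g = 0 := by simpa using Submodule.subset_span hg
        have : φ.comp S.mkQL g = 0 := by
          change φ (S.mkQ g) = 0
          rw [this, map_zero]
        simpa [this] using hδ) p hp
    have h2 : φ.comp S.mkQL p = ‖S.mkQ p‖ := hφp
    rw [h2, abs_norm] at h1
    obtain ⟨m, hm, hmn⟩ := Submodule.Quotient.norm_mk_lt (S := S) (S.mkQ p) (sub_pos.2 h1)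
    refine ⟨p - m, (Submodule.Quotient.eq S).1 hm.symm, ?_⟩
    rw [sub_sub_cancel]
    linarith
  have hcomp : IsCompact ((↑) '' Metric.closedBall (0 : S) (R + ε / 2) : Set E) :=
    (isCompact_closedBall _ _).image continuous_subtype_val
  obtain ⟨t, ht, hcov⟩ := Metric.totallyBounded_iff.1 hcomp.totallyBounded (ε / 2) (half_pos hε)
  refine ⟨t, ht, fun p hp => ?_⟩
  obtain ⟨s, hs, hps⟩ := hnear p hp
  have hsn : ‖s‖ ≤ R + ε / 2 := by
    have h1 : ‖s‖ ≤ ‖p‖ + ‖p - s‖ := by simpa using norm_sub_le p (p - s)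
    linarith [hR p hp]
  have hmem : s ∈ ((↑) '' Metric.closedBall (0 : S) (R + ε / 2) : Set E) :=
    ⟨⟨s, hs⟩, by simpa using hsn, rfl⟩
  obtain ⟨y, hy, hsy⟩ := mem_iUnion₂.1 (hcov hmem)
  refine mem_iUnion₂.2 ⟨y, hy, ?_⟩
  rw [Metric.mem_ball] at hsy ⊢
  rw [← dist_eq_norm] at hps
  linarith [dist_triangle p s y]

theorem mem_nhds_tauZero {X : Type*} [NormedAddCommGroup X] [NormedSpace ℝ X]
    {P : Set (StrongDual ℝ X)} (hP : MackeyPrecompact P) {ε : ℝ} (hε : 0 < ε) :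
    {φ : StrongDual ℝ (StrongDual ℝ X) | ∀ p ∈ P, |φ p| < ε} ∈ @nhds _ (tauZero X) 0 := by
  rw [tauZero, nhds_induced]
  refine mem_comap.2 ⟨_, UniformConvergenceCLM.eventually_nhds_zero_mapsTo (RingHom.id ℝ)
    (F := ℝ) (𝔖 := {P : Set (StrongDual ℝ X) | MackeyPrecompact P}) hP
    (Metric.ball_mem_nhds 0 hε), fun φ hφ p hp => ?_⟩
  exact mem_ball_zero_iff.1 (hφ hp)

theorem exists_finite_of_mem_nhds_weakStarBidual {X : Type*} [NormedAddCommGroup X]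
    [NormedSpace ℝ X] {V : Set (StrongDual ℝ (StrongDual ℝ X))}
    (hV : V ∈ @nhds _ (weakStarBidual X) 0) :
    ∃ (F : Set (StrongDual ℝ X)) (δ : ℝ), F.Finite ∧ 0 < δ ∧
      ∀ φ : StrongDual ℝ (StrongDual ℝ X), (∀ g ∈ F, |φ g| < δ) → φ ∈ V := by
  rw [weakStarBidual, nhds_induced, mem_comap] at hV
  obtain ⟨W, hW, hWV⟩ := hV
  have hind : (𝓝 (0 : WeakDual ℝ (StrongDual ℝ X))) =
      comap (fun (φ : WeakDual ℝ (StrongDual ℝ X)) g => φ g) (𝓝 0) := nhds_induced _ _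
  rw [map_zero, hind, mem_comap] at hW
  obtain ⟨U, hU, hUW⟩ := hW
  rw [nhds_pi, Filter.mem_pi] at hU
  obtain ⟨F, hF, t, ht, htU⟩ := hU
  have hball := fun g => Metric.mem_nhds_iff.1 (ht g)
  choose r hr hrt using hball
  -- A basic weak* neighbourhood restricts finitely many coordinates; `δ` is their least radius.
  obtain ⟨δ, hδ, hδr⟩ : ∃ δ > 0, ∀ g ∈ F, δ ≤ r g := by
    rcases F.eq_empty_or_nonempty with rfl | hne
    · exact ⟨1, one_pos, by simp⟩
    · obtain ⟨g, -, hg⟩ := hF.exists_minimalFor r F hne |>.imp fun g h =>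
        (⟨h.1, fun k hk => (le_total (r k) (r g)).elim (h.2 hk) id⟩ :
          g ∈ F ∧ ∀ k ∈ F, r g ≤ r k)
      exact ⟨r g, hr g, hg⟩
  refine ⟨F, δ, hF, hδ, fun φ hφ => hWV (hUW (htU fun g hg => hrt g ?_))⟩
  simpa using! (hφ g hg).trans_le (hδr g hg)

theorem theorem3p11 (X : Type*) [NormedAddCommGroup X] [NormedSpace ℝ X] [CompleteSpace X]
    (hagree : ∀ B : Set (StrongDual ℝ (StrongDual ℝ X)), Bornology.IsBounded B →
      TopologicalSpace.induced (Subtype.val : B → StrongDual ℝ (StrongDual ℝ X)) (tauZero X) =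
        TopologicalSpace.induced (Subtype.val : B → StrongDual ℝ (StrongDual ℝ X))
          (weakStarBidual X)) :
    (∀ P : Set (StrongDual ℝ X), MackeyPrecompact P → IsCompact (closure P)) ∧
      ¬ ContainsEllOne X := by
  have hcompact : ∀ P : Set (StrongDual ℝ X), MackeyPrecompact P → IsCompact (closure P) := by
    intro P hP
    suffices TotallyBounded P from
      isCompact_iff_totallyBounded_isComplete.2 ⟨this.closure, isClosed_closure.isComplete⟩
    refine totallyBounded_of_equicontinuous_zero fun ε hε => ?_
    let B : Set (StrongDual ℝ (StrongDual ℝ X)) := Metric.closedBall 0 1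
    let z : B := ⟨0, by simp [B]⟩
    -- Only the neighbourhoods of `0` in the unit ball are compared.
    have hnhds := congrArg (fun τ : TopologicalSpace B => @nhds B τ z)
      (hagree B Metric.isBounded_closedBall)
    simp only [nhds_induced] at hnhds
    have h1 := preimage_mem_comap (m := (Subtype.val : B → _)) (mem_nhds_tauZero hP hε)
    obtain ⟨V, hV, hVsub⟩ := mem_comap.1 (hnhds ▸ h1)
    obtain ⟨F, δ, hF, hδ, h⟩ := exists_finite_of_mem_nhds_weakStarBidual hV
    exact ⟨F, δ, hF, hδ, fun φ hφ hφF =>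
      hVsub (show (⟨φ, mem_closedBall_zero_iff.2 hφ⟩ : B) ∈ _ from h φ hφF)⟩
  refine ⟨hcompact, fun hX => ?_⟩
  obtain ⟨P, hP, hP'⟩ := exists_mackeyPrecompact_not_isCompact_closure hX
  exact hP' (hcompact P hP)
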